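/- Let $d\ge 0$ and $w\ge 0$ be integers. Consider finite sets $P$ of points of $\mathbb R^d$ with integer coordinates in $\{0,\dots,2^w-1\}$ (the $w$-bit coordinates). Encoding. The Morton number of such a point is the $dw$-bit integer obtained by interleaving the bits of its coordinates (from the most significant bits to the least significant bits, first coordinate first), and the Morton order sorts points by Morton number. The gamma code of an integer $a\ge 1$ with $k$ binary digits is the $2k$-bit string consisting of $k$ zeros followed by the binary digits of $a$; the gamma code of $0$ is the single bit $1$. The xor-code of a list $a_1,\dots,a_n$ of $w$-bit integers consists of the $w$ bits of $a_1$ followed by the gamma codes of $a_j \mathbin{\mathrm{xor}} a_{j-1}$ for $j=2,\dots,n$ (it is empty for $n=0$). Let $\mathrm{code}(P)$ be the bit string consisting of the gamma code of $n=|P|$ followed by, for each of the $d$ dimensions in turn, the xor-code of the list of coordinates in that dimension of the points of $P$ taken in Morton order. Nets. Let $S\subset\mathbb R^d$ and let $f:S\to\mathbb R$ satisfy $f(x)\le f(y)+|xy|$ for all $x,y\in S$, where $|xy|$ is the Euclidean distance. A set $P\subset S$ is an $\epsilon$-net over $S$ with respect to $f$ if for every $x\in S$ there is $p\in P$ with $|px|\le\epsilon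 f(x)$, and $|pq|\ge f(p)$ for all distinct $p,q\in P$. Theorem. (i) The encoding is lossless: for all $d$ and $w$ there is a decoding map, depending only on $d$ and $w$, that recovers every such $P$ from $\mathrm{code}(P)$. (ii) For all $d$ and all real $f_0,\epsilon$ there is a constant $C$, depending only on $f_0$, $\epsilon$ and $d$, such that for every $w$, every nonempty compact connected $S\subset\mathbb R^d$, and every set $P$ of $n$ points with integer coordinates in $\{0,\dots,2^w-1\}$ that is an $\epsilon$-net over $S$ with respect to the constant function $f\equiv f_0$ on $S$, the string $\mathrm{code}(P)$ has at most $C\,(w+n)$ bits. -/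

import Mathlib

/-- A point of the `d`-dimensional integer grid with coordinates in `{0, …, 2 ^ w - 1}`. -/
abbrev GridPoint (d w : ℕ) : Type := Fin d → Fin (2 ^ w)

/-- A grid point as a point of Euclidean space `ℝ ^ d`. -/
noncomputable def GridPoint.toEuclidean {d w : ℕ} (p : GridPoint d w) :
    EuclideanSpace ℝ (Fin d) :=
  WithLp.toLp 2 fun i => ((p i : ℕ) : ℝ)

/-- `P` is an `ε`-net over `S ⊆ ℝ ^ d` with respect to the sizing function `f`
(only the values of `f` on `S` matter). -/
structure IsEpsNet {d : ℕ} (S : Set (EuclideanSpace ℝ (Fin d)))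
    (f : EuclideanSpace ℝ (Fin d) → ℝ) (ε : ℝ) (P : Set (EuclideanSpace ℝ (Fin d))) : Prop where
  lipschitz : ∀ x ∈ S, ∀ y ∈ S, f x ≤ f y + dist x y
  subset : P ⊆ S
  covering : ∀ x ∈ S, ∃ p ∈ P, dist p x ≤ ε * f x
  separated : ∀ p ∈ P, ∀ q ∈ P \ {p}, f p ≤ dist p q

/-- The Morton number: the `w * d`-bit integer obtained by interleaving the bits of the
coordinates. Bit number `b * d + j` (counted from the least significant bit, `j < d`) is bit `b`
of coordinate `d - 1 - j`, so that within each group of `d` bits the first coordinate comes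
first (is the most significant). -/
def mortonNumber {d w : ℕ} (p : GridPoint d w) : ℕ :=
  Nat.ofBits fun k : Fin (w * d) =>
    (p (finProdFinEquiv.symm k).2.rev : ℕ).testBit (finProdFinEquiv.symm k).1

theorem mortonNumber_injective (d w : ℕ) :
    Function.Injective (mortonNumber : GridPoint d w → ℕ) := by
  intro p q h
  funext i
  apply Fin.ext
  apply Nat.eq_of_testBit_eq
  intro b
  by_cases hb : b < w
  · have h2 := congrArg
      (fun m => m.testBit (finProdFinEquiv ((⟨b, hb⟩ : Fin w), i.rev) : Fin (w * d))) h
    simpa only [mortonNumber, Nat.testBit_ofBits_lt, Fin.is_lt, Fin.eta,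
      Equiv.symm_apply_apply, Fin.rev_rev] using h2
  · have hw : 2 ^ w ≤ 2 ^ b := Nat.pow_le_pow_right (by norm_num) (by omega)
    rw [Nat.testBit_lt_two_pow ((p i).isLt.trans_le hw),
      Nat.testBit_lt_two_pow ((q i).isLt.trans_le hw)]

/-- The Morton order (Z-order): comparison of Morton numbers. -/
def mortonLE {d w : ℕ} (p q : GridPoint d w) : Prop := mortonNumber p ≤ mortonNumber q

instance mortonLE.decidableRel {d w : ℕ} : DecidableRel (mortonLE (d := d) (w := w)) :=
  fun p q => Nat.decLe (mortonNumber p) (mortonNumber q)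

instance mortonLE.isTrans {d w : ℕ} : IsTrans (GridPoint d w) mortonLE :=
  ⟨fun _ _ _ h h' => Nat.le_trans h h'⟩

instance mortonLE.antisymm {d w : ℕ} : Std.Antisymm (mortonLE (d := d) (w := w)) :=
  ⟨fun _ _ h h' => mortonNumber_injective d w (Nat.le_antisymm h h')⟩

instance mortonLE.total {d w : ℕ} : Std.Total (mortonLE (d := d) (w := w)) :=
  ⟨fun p q => Nat.le_total (mortonNumber p) (mortonNumber q)⟩

/-- The points of `P`, listed in increasing Morton order. -/
def mortonSort {d w : ℕ} (P : Finset (GridPoint d w)) : List (GridPoint d w) :=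
  P.sort mortonLE

/-- The `k` low bits of `a`, most significant bit first. -/
def longhand (k a : ℕ) : List Bool :=
  (List.range k).reverse.map fun i => a.testBit i

/-- The gamma code of a natural number: the number of binary digits in unary (with zeros),
then the binary digits, starting with the leading one. The code of `0` is the single bit `1`. -/
def gammaCode (a : ℕ) : List Bool :=
  if a = 0 then [true] else List.replicate a.size false ++ longhand a.size a

/-- The xor-code of an array of `w`-bit integers: the first entry in longhand (`w` bits), then
the gamma codes of the bitwise exclusive ors of each later entry with its predecessor. -/
def xorCode (w : ℕ) : List ℕ → List Bool
  | [] => []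
  | a :: l => longhand w a ++ (List.zipWith (fun x y => x ^^^ y) l (a :: l)).flatMap gammaCode

/-- The stored bit string: the number of points (gamma-coded, so that the string can be split
into its parts), and then, for each dimension in turn, the xor-code of the array of the
coordinates of the points in that dimension, the points being listed in Morton order. -/
def xorCompress {d w : ℕ} (P : Finset (GridPoint d w)) : List Bool :=
  gammaCode P.card ++
    (List.finRange d).flatMap fun i => xorCode w ((mortonSort P).map fun p => (p i : ℕ))

/-!
The encoding is lossless because it is assembled from self-delimiting parts: a gamma code announces
its own length by its leading zeros (`gammaCode_append_inj`), and once the number of points is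
known, each xor-code in turn can be read off the front of the string (`xorCode_append_inj`).

For the length, the cost of a step between Morton-consecutive points `p`, `q` in one dimension is
governed by the number of binary digits of an exclusive or, which is at most the number of levels
`h < w` on which `p` and `q` lie in different cells of side `2 ^ h`. The points of a cell are
consecutive in Morton order, so the steps that change the cell on level `h` are fewer than the
occupied cells `N h` of that level, and the code has at most `O(w + n + ∑ h, N h)` bits
(`length_xorCompress_le`).

The covering by balls of radius `R = ε * f₀` and the connectedness of `S` bound `N h`. If some
point is within `2 ^ h` of all others, then `N h ≤ 3 ^ d`. Otherwise the distance from a point `p`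
in an occupied cell takes on `S` all values up to `2 ^ h`, which forces at least
`2 ^ h / (3 * R + 1)` points within `2 ^ h` of `p` (`le_mul_card_of_isPreconnected`). These lie in the `3 ^ d` cells
around the cell of `p`, so double counting gives `N h ≤ (3 * R + 1) * 3 ^ d * n / 2 ^ h`. The sum
of the two bounds over `h < w` is `O(w + n)`.
-/

/-! ### Unique decodability -/

theorem length_longhand (k a : ℕ) : (longhand k a).length = k := by
  simp [longhand]

theorem longhand_inj {k a b : ℕ} (ha : a < 2 ^ k) (hb : b < 2 ^ k)
    (h : longhand k a = longhand k b) : a = b := by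
  apply Nat.eq_of_testBit_eq
  intro i
  by_cases hi : i < k
  · exact List.map_inj_left.1 h i (by simpa using hi)
  · have hk : 2 ^ k ≤ 2 ^ i := Nat.pow_le_pow_right (by norm_num) (by omega)
    rw [Nat.testBit_lt_two_pow (ha.trans_le hk), Nat.testBit_lt_two_pow (hb.trans_le hk)]

theorem longhand_size_eq_cons {a : ℕ} (ha : a ≠ 0) :
    ∃ t, t.length + 1 = a.size ∧ longhand a.size a = true :: t := by
  obtain ⟨k, hk⟩ := Nat.exists_eq_succ_of_ne_zero (Nat.size_pos.2 (Nat.pos_of_ne_zero ha)).ne'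
  have h1 : 2 ^ k ≤ a := Nat.lt_size.1 (by omega)
  have h2 : a < 2 ^ (k + 1) := Nat.size_le.1 hk.le
  have hbit : a.testBit k = true := by
    rw [Nat.testBit_eq_decide_div_mod_eq, Nat.div_eq_of_lt_le (k := 1)] <;>
      simp [pow_succ] at * <;> omega
  refine ⟨(List.range k).reverse.map fun i => a.testBit i, by simp [hk], ?_⟩
  simp [hk, longhand, List.range_succ, hbit]

/-- A gamma code starts with as many zeros as there are binary digits, and a one follows: its
first one therefore marks the length of the part that is still to be read. -/
theorem gammaCode_eq (a : ℕ) :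
    ∃ t, t.length = a.size - 1 ∧ gammaCode a = List.replicate a.size false ++ true :: t := by
  by_cases ha : a = 0
  · exact ⟨[], by simp [ha], by simp [ha, gammaCode]⟩
  · obtain ⟨t, ht, h⟩ := longhand_size_eq_cons ha
    exact ⟨t, by omega, by simp [gammaCode, ha, h]⟩

theorem replicate_false_append_true_inj {m n : ℕ} {x y : List Bool}
    (h : List.replicate m false ++ true :: x = List.replicate n false ++ true :: y) :
    m = n ∧ x = y := by
  induction m generalizing n with
  | zero => cases n <;> simp_all [List.replicate_succ]
  | succ m ih =>
    cases n with
    | zero => simp [List.replicate_succ] at h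
    | succ n =>
      simp only [List.replicate_succ, List.cons_append, List.cons.injEq, true_and] at h
      exact ⟨congrArg _ (ih h).1, (ih h).2⟩

/-- The gamma code is a prefix code. -/
theorem gammaCode_append_inj {a b : ℕ} {x y : List Bool}
    (h : gammaCode a ++ x = gammaCode b ++ y) : a = b ∧ x = y := by
  obtain ⟨s, hs, hsa⟩ := gammaCode_eq a
  obtain ⟨t, ht, htb⟩ := gammaCode_eq b
  have h' := h
  rw [hsa, htb, List.append_assoc, List.append_assoc, List.cons_append, List.cons_append] at h'
  obtain ⟨hsize, htail⟩ := replicate_false_append_true_inj h'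
  obtain ⟨rfl, rfl⟩ := List.append_inj htail (by omega)
  refine ⟨?_, rfl⟩
  have hab : gammaCode a = gammaCode b := by rw [hsa, htb, hsize]
  by_cases ha : a = 0
  · rw [ha, Nat.size_zero] at hsize
    rw [ha, Nat.size_eq_zero.1 hsize.symm]
  · have hb : b ≠ 0 := fun hb =>
      ha (Nat.size_eq_zero.1 (by rw [hsize, hb, Nat.size_zero]))
    rw [gammaCode, gammaCode, if_neg ha, if_neg hb, hsize] at hab
    exact longhand_inj (hsize ▸ Nat.lt_size_self a) (Nat.lt_size_self b)
      (List.append_cancel_left hab)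

theorem xor_gammaCode_append_inj {a : ℕ} {l m : List ℕ} (hlm : l.length = m.length)
    {x y : List Bool}
    (h : (List.zipWith (fun x y => x ^^^ y) l (a :: l)).flatMap gammaCode ++ x =
      (List.zipWith (fun x y => x ^^^ y) m (a :: m)).flatMap gammaCode ++ y) :
    l = m ∧ x = y := by
  induction l generalizing a m with
  | nil =>
    obtain rfl : m = [] := List.length_eq_zero_iff.1 hlm.symm
    exact ⟨rfl, by simpa using h⟩
  | cons b l ih =>
    cases m with
    | nil => simp at hlm
    | cons c m =>
      simp only [List.zipWith_cons_cons, List.flatMap_cons, List.append_assoc] at h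
      obtain ⟨hbc, h⟩ := gammaCode_append_inj h
      obtain rfl : b = c := Nat.xor_left_injective hbc
      obtain ⟨rfl, hxy⟩ := ih (by simpa using hlm) h
      exact ⟨rfl, hxy⟩

/-- A list of known length can be read off from any string that starts with its xor-code. -/
theorem xorCode_append_inj {w : ℕ} {l m : List ℕ} (hl : ∀ a ∈ l, a < 2 ^ w)
    (hm : ∀ a ∈ m, a < 2 ^ w) (hlm : l.length = m.length) {x y : List Bool}
    (h : xorCode w l ++ x = xorCode w m ++ y) : l = m ∧ x = y := by
  cases l with
  | nil =>
    obtain rfl : m = [] := List.length_eq_zero_iff.1 hlm.symm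
    exact ⟨rfl, h⟩
  | cons a l =>
    cases m with
    | nil => simp at hlm
    | cons b m =>
      simp only [xorCode, List.append_assoc] at h
      obtain ⟨hab, h⟩ := List.append_inj h (by rw [length_longhand, length_longhand])
      obtain rfl : a = b := longhand_inj (hl a (by simp)) (hm b (by simp)) hab
      obtain ⟨rfl, hxy⟩ := xor_gammaCode_append_inj (by simpa using hlm) h
      exact ⟨rfl, hxy⟩

theorem flatMap_xorCode_inj {d w : ℕ} {l m : List (GridPoint d w)} (hlm : l.length = m.length)
    {is : List (Fin d)}
    (h : (is.flatMap fun i => xorCode w (l.map fun p => (p i : ℕ))) =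
      is.flatMap fun i => xorCode w (m.map fun p => (p i : ℕ))) :
    ∀ i ∈ is, (l.map fun p => (p i : ℕ)) = m.map fun p => (p i : ℕ) := by
  induction is with
  | nil => simp
  | cons i is ih =>
    simp only [List.flatMap_cons] at h
    obtain ⟨hi, his⟩ := xorCode_append_inj (by simp) (by simp) (by simpa using hlm) h
    simpa using And.intro hi (by simpa using ih his)

theorem xorCompress_injective (d w : ℕ) :
    Function.Injective (xorCompress : Finset (GridPoint d w) → List Bool) := by
  intro P Q h
  obtain ⟨hcard, h⟩ := gammaCode_append_inj h
  have hlen : (mortonSort P).length = (mortonSort Q).length := by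
    simpa [mortonSort, Finset.length_sort] using hcard
  have hcoord := flatMap_xorCode_inj hlen h
  have hsort : mortonSort P = mortonSort Q := by
    refine List.ext_getElem hlen fun k hk hk' => funext fun i => Fin.ext ?_
    have := congrArg (fun l => l[k]?) (hcoord i (List.mem_finRange i))
    simpa [hk, hk'] using this
  simpa [mortonSort, Finset.sort_toFinset] using congrArg List.toFinset hsort

/-! ### The code length as a count of grid cells -/

theorem length_gammaCode_le (a : ℕ) : (gammaCode a).length ≤ 2 * a.size + 1 := by
  obtain ⟨t, ht, h⟩ := gammaCode_eq a
  rw [h]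
  simp
  omega

/-- The binary digits of `x ^^^ y` are as many as the numbers of low bits that may be dropped
while `x` and `y` still differ. -/
theorem size_xor_le_card {w x y : ℕ} (hx : x < 2 ^ w) (hy : y < 2 ^ w) :
    (x ^^^ y).size ≤ ((Finset.range w).filter fun h => x >>> h ≠ y >>> h).card := by
  calc (x ^^^ y).size = (Finset.range (x ^^^ y).size).card := (Finset.card_range _).symm
    _ ≤ _ := Finset.card_le_card fun h hh => ?_
  rw [Finset.mem_range] at hh
  rw [Finset.mem_filter, Finset.mem_range]
  refine ⟨hh.trans_le (Nat.size_le.2 (Nat.xor_lt_two_pow hx hy)), fun heq => ?_⟩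
  have h1 : (x ^^^ y) / 2 ^ h = 0 := by
    rw [← Nat.shiftRight_eq_div_pow, Nat.shiftRight_xor_distrib, heq, Nat.xor_self]
  exact (Nat.div_pos (Nat.lt_size.1 hh) (by positivity)).ne' h1

theorem testBit_mortonNumber {d w : ℕ} (p : GridPoint d w) (b : Fin w) (j : Fin d) :
    (mortonNumber p).testBit (j + d * b) = (p j.rev : ℕ).testBit b := by
  have h := Nat.testBit_ofBits_lt (fun k : Fin (w * d) =>
    (p (finProdFinEquiv.symm k).2.rev : ℕ).testBit (finProdFinEquiv.symm k).1)
    (finProdFinEquiv (b, j)) (finProdFinEquiv (b, j)).isLt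
  simp only [Fin.eta, Equiv.symm_apply_apply] at h
  exact h

/-- The cell of side `2 ^ h` of the integer grid that contains `p`, given by its coordinates. -/
def gridCell {d w : ℕ} (h : ℕ) (p : GridPoint d w) : Fin d → ℕ := fun i => (p i : ℕ) >>> h

/-- Two points lie in the same cell of side `2 ^ h` exactly when their Morton numbers agree up to
the last `h * d` bits. -/
theorem mortonNumber_shiftRight_eq_iff {d w : ℕ} (h : ℕ) (p q : GridPoint d w) :
    mortonNumber p >>> (d * h) = mortonNumber q >>> (d * h) ↔ gridCell h p = gridCell h q := by
  constructor
  · intro heq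
    funext i
    apply Nat.eq_of_testBit_eq
    intro b
    simp only [gridCell, Nat.testBit_shiftRight]
    by_cases hb : h + b < w
    · have h1 := congrArg (fun m => m.testBit (i.rev + d * b)) heq
      simp only [Nat.testBit_shiftRight] at h1
      rw [show d * h + ((i.rev : ℕ) + d * b) = i.rev + d * (⟨h + b, hb⟩ : Fin w) by
        simp only []; ring] at h1
      rwa [testBit_mortonNumber, testBit_mortonNumber, Fin.rev_rev] at h1
    · have hw : 2 ^ w ≤ 2 ^ (h + b) := Nat.pow_le_pow_right (by norm_num) (by omega)
      rw [Nat.testBit_lt_two_pow ((p i).isLt.trans_le hw),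
        Nat.testBit_lt_two_pow ((q i).isLt.trans_le hw)]
  · intro heq
    apply Nat.eq_of_testBit_eq
    intro k
    simp only [Nat.testBit_shiftRight]
    by_cases hk : d * h + k < w * d
    · obtain ⟨⟨b, j⟩, hbj⟩ := finProdFinEquiv.surjective (⟨d * h + k, hk⟩ : Fin (w * d))
      have hval : (j : ℕ) + d * b = d * h + k := congrArg Fin.val hbj
      have hhb : h ≤ b := by
        by_contra! hlt
        have : d * (b + 1) ≤ d * h := Nat.mul_le_mul_left d hlt
        have := j.isLt
        rw [Nat.mul_add] at *
        omega
      have h1 := congrArg (fun m => m.testBit (b - h)) (congrFun heq j.rev)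
      simp only [gridCell, Nat.testBit_shiftRight] at h1
      rw [← hval, testBit_mortonNumber, testBit_mortonNumber]
      rwa [Nat.add_sub_cancel' hhb] at h1
    · rw [mortonNumber, mortonNumber, Nat.testBit_ofBits_ge _ _ (by omega),
        Nat.testBit_ofBits_ge _ _ (by omega)]

/-- Along a Morton-sorted list the points of a cell are consecutive, so a step into another cell
is a step into a new cell. -/
theorem card_gridCell_cons_cons {d w : ℕ} {p q : GridPoint d w} {l : List (GridPoint d w)}
    (hs : (p :: q :: l).Pairwise mortonLE) (h : ℕ) :
    ((q :: l).toFinset.image (gridCell h)).card + (if gridCell h p ≠ gridCell h q then 1 else 0) ≤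
      ((p :: q :: l).toFinset.image (gridCell h)).card := by
  rw [List.toFinset_cons (a := p), Finset.image_insert]
  split_ifs with hpq
  · rw [Finset.card_insert_of_notMem]
    intro hmem
    obtain ⟨r, hr, hrp⟩ := Finset.mem_image.1 hmem
    rw [List.mem_toFinset] at hr
    rw [List.pairwise_cons] at hs
    have hle : mortonNumber p ≤ mortonNumber q := hs.1 q (by simp)
    have hle' : mortonNumber q ≤ mortonNumber r := by
      rcases List.mem_cons.1 hr with rfl | hr
      · exact le_rfl
      · exact (List.pairwise_cons.1 hs.2).1 r hr
    -- The Morton number of `q` lies between those of two points of the cell of `p`.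
    rw [← mortonNumber_shiftRight_eq_iff] at hrp
    refine hpq ((mortonNumber_shiftRight_eq_iff h p q).1 (le_antisymm ?_ ?_))
    · simp only [Nat.shiftRight_eq_div_pow]
      exact Nat.div_le_div_right hle
    · rw [← hrp]
      simp only [Nat.shiftRight_eq_div_pow]
      exact Nat.div_le_div_right hle'
  · rw [Nat.add_zero]
    exact Finset.card_le_card (Finset.subset_insert _ _)

/-- In a step between consecutive points the number of binary digits of the exclusive or is at
most the number of levels on which the step changes the cell, and on each level these changes are
counted by the cells visited. -/
theorem length_xor_gammaCode_le {d w : ℕ} (i : Fin d) (p : GridPoint d w)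
    (l : List (GridPoint d w)) (hs : (p :: l).Pairwise mortonLE) :
    ((List.zipWith (fun x y => x ^^^ y) (l.map fun p => (p i : ℕ))
      ((p i : ℕ) :: l.map fun p => (p i : ℕ))).flatMap gammaCode).length ≤
      l.length + 2 * ∑ h ∈ Finset.range w, ((p :: l).toFinset.image (gridCell h)).card := by
  induction l generalizing p with
  | nil => simp
  | cons q l ih =>
    have hstep : ((q i : ℕ) ^^^ (p i : ℕ)).size ≤
        ∑ h ∈ Finset.range w, if gridCell h p ≠ gridCell h q then 1 else 0 := by
      rw [← Finset.card_filter]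
      refine (size_xor_le_card (q i).isLt (p i).isLt).trans (Finset.card_le_card ?_)
      refine Finset.monotone_filter_right _ fun h _ hne heq => hne ?_
      exact (congrFun heq i).symm
    have hsum := Finset.sum_le_sum fun h (_ : h ∈ Finset.range w) => card_gridCell_cons_cons hs h
    rw [Finset.sum_add_distrib] at hsum
    have hih := ih q (List.pairwise_cons.1 hs).2
    have hg := length_gammaCode_le ((q i : ℕ) ^^^ (p i : ℕ))
    simp only [List.map_cons, List.zipWith_cons_cons, List.flatMap_cons, List.length_append,
      List.length_cons]
    omega

theorem length_xorCode_le {d w : ℕ} (i : Fin d) (P : Finset (GridPoint d w)) :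
    (xorCode w ((mortonSort P).map fun p => (p i : ℕ))).length ≤
      w + P.card + 2 * ∑ h ∈ Finset.range w, (P.image (gridCell h)).card := by
  have hs : (mortonSort P).Pairwise mortonLE := Finset.pairwise_sort P mortonLE
  have hP : (mortonSort P).toFinset = P := Finset.sort_toFinset (r := mortonLE) P
  have hlen : (mortonSort P).length = P.card := Finset.length_sort (s := P) mortonLE
  revert hs hP hlen
  generalize mortonSort P = l
  rintro hs rfl hlen
  cases l with
  | nil => simp [xorCode]
  | cons p l =>
    have := length_xor_gammaCode_le i p l hs
    rw [List.length_cons] at hlen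
    simp only [List.map_cons, xorCode, List.length_append, length_longhand]
    omega

theorem length_xorCompress_le {d w : ℕ} {P : Finset (GridPoint d w)} (hP : P.Nonempty) :
    (xorCompress P).length ≤ 3 * P.card +
      d * (w + P.card + 2 * ∑ h ∈ Finset.range w, (P.image (gridCell h)).card) := by
  have h1 : (gammaCode P.card).length ≤ 3 * P.card := by
    have hs : P.card.size ≤ P.card := Nat.size_le.2 Nat.lt_two_pow_self
    have := length_gammaCode_le P.card
    have := hP.card_pos
    omega
  have h2 := List.sum_le_card_nsmul
    ((List.finRange d).map fun i => (xorCode w ((mortonSort P).map fun p => (p i : ℕ))).length)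
    (w + P.card + 2 * ∑ h ∈ Finset.range w, (P.image (gridCell h)).card)
    (by simpa using fun i => length_xorCode_le i P)
  rw [xorCompress, List.length_append, List.length_flatMap]
  simp only [List.length_map, List.length_finRange, smul_eq_mul] at h2
  exact Nat.add_le_add h1 h2

/-! ### Counting cells near a connected set -/

/-- By connectedness, the distance from `g p` takes on `S` every value between `0` and `L`; the
values spaced by `2 * R + 1` are approximated within `R` by distances to distinct points of the
covering. -/
theorem le_mul_card_of_isPreconnected {X α : Type*} [PseudoMetricSpace X] {S : Set X}
    (hS : IsPreconnected S) {P : Finset α} {g : α → X} (hPS : ∀ q ∈ P, g q ∈ S) {R : ℝ}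
    (hR : 0 ≤ R) (hcov : ∀ x ∈ S, ∃ q ∈ P, dist (g q) x ≤ R) {p r : α} (hp : p ∈ P) (hr : r ∈ P)
    {L : ℝ} (hL : 0 ≤ L) (hLr : L ≤ dist (g p) (g r)) :
    L ≤ (3 * R + 1) * (P.filter fun q => dist (g p) (g q) ≤ L).card := by
  set A := P.filter fun q => dist (g p) (g q) ≤ L with hA
  have hA1 : (1 : ℝ) ≤ A.card := by
    have : p ∈ A := by simp [hA, hp, hL]
    exact_mod_cast Finset.card_pos.2 ⟨p, this⟩
  rcases lt_or_ge L R with hLR | hLR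
  -- Below `R` the point `p` alone is enough.
  · nlinarith
  set N := ⌊(L - R) / (2 * R + 1)⌋₊ with hN
  have hD : 0 < 2 * R + 1 := by linarith
  have hex : ∀ k ∈ Finset.range (N + 1), ∃ q ∈ P, |dist (g p) (g q) - k * (2 * R + 1)| ≤ R := by
    intro k hk
    have hkN : (k : ℝ) ≤ (L - R) / (2 * R + 1) :=
      (Nat.le_floor_iff (div_nonneg (by linarith) hD.le)).1 (Finset.mem_range_succ_iff.1 hk)
    rw [le_div_iff₀ hD] at hkN
    obtain ⟨x, hxS, hx⟩ := hS.intermediate_value (hPS p hp) (hPS r hr)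
      (f := fun x => dist (g p) x) (by fun_prop)
      (show (k : ℝ) * (2 * R + 1) ∈ Set.Icc (dist (g p) (g p)) (dist (g p) (g r)) from
        ⟨by rw [dist_self]; positivity, by linarith⟩)
    obtain ⟨q, hq, hqx⟩ := hcov x hxS
    refine ⟨q, hq, ?_⟩
    rw [← hx]
    have h1 := dist_triangle (g p) x (g q)
    have h2 := dist_triangle (g p) (g q) x
    rw [dist_comm x] at h1
    exact abs_le.2 ⟨by linarith, by linarith⟩
  have : Nonempty α := ⟨p⟩
  choose! q hqP hq using hex
  have hcard : N + 1 ≤ A.card := by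
    rw [← Finset.card_range (N + 1)]
    refine Finset.card_le_card_of_injOn q (fun k hk => ?_) fun k hk k' hk' heq => ?_
    · have hkN : (k : ℝ) ≤ (L - R) / (2 * R + 1) :=
        (Nat.le_floor_iff (div_nonneg (by linarith) hD.le)).1 (Finset.mem_range_succ_iff.1 hk)
      rw [le_div_iff₀ hD] at hkN
      have := (abs_le.1 (hq k hk)).2
      exact Finset.mem_filter.2 ⟨hqP k hk, by linarith⟩
    · have h1 := abs_le.1 (hq k hk)
      have h2 := abs_le.1 (hq k' hk')
      rw [heq] at h1
      by_contra hne
      rcases lt_or_gt_of_ne hne with hlt | hlt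
      · have : (k : ℝ) + 1 ≤ k' := by exact_mod_cast hlt
        nlinarith
      · have : (k' : ℝ) + 1 ≤ k := by exact_mod_cast hlt
        nlinarith
  have hfloor := Nat.lt_floor_add_one ((L - R) / (2 * R + 1))
  rw [div_lt_iff₀ hD, ← hN] at hfloor
  have hcard' : (N : ℝ) + 1 ≤ A.card := by exact_mod_cast hcard
  nlinarith

theorem val_le_add_of_dist_le {d w h : ℕ} {p q : GridPoint d w}
    (hpq : dist p.toEuclidean q.toEuclidean ≤ 2 ^ h) (i : Fin d) :
    (p i : ℕ) ≤ q i + 2 ^ h := by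
  have h1 := PiLp.norm_apply_le (p.toEuclidean - q.toEuclidean) i
  rw [← dist_eq_norm, Real.norm_eq_abs] at h1
  have h2 := (le_abs_self _).trans (h1.trans hpq)
  simp only [GridPoint.toEuclidean, PiLp.sub_apply, sub_le_iff_le_add'] at h2
  exact_mod_cast h2

/-- The cells that share at least a corner with `c`, together with `c`. -/
def neighborCells {d : ℕ} (c : Fin d → ℕ) : Finset (Fin d → ℕ) :=
  Fintype.piFinset fun i => Finset.Icc (c i - 1) (c i + 1)

theorem card_neighborCells_le {d : ℕ} (c : Fin d → ℕ) : (neighborCells c).card ≤ 3 ^ d := by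
  rw [neighborCells, Fintype.card_piFinset]
  refine (Finset.prod_le_pow_card _ _ 3 fun i _ => ?_).trans (by simp)
  rw [Nat.card_Icc]
  omega

theorem gridCell_mem_neighborCells {d w h : ℕ} {p q : GridPoint d w}
    (hpq : dist p.toEuclidean q.toEuclidean ≤ 2 ^ h) :
    gridCell h p ∈ neighborCells (gridCell h q) := by
  have hqp := hpq
  rw [dist_comm] at hqp
  refine Fintype.mem_piFinset.2 fun i => Finset.mem_Icc.2 ?_
  have h1 := Nat.div_le_div_right (c := 2 ^ h) (val_le_add_of_dist_le hpq i)
  have h2 := Nat.div_le_div_right (c := 2 ^ h) (val_le_add_of_dist_le hqp i)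
  rw [Nat.add_div_right _ (by positivity)] at h1 h2
  simp only [gridCell, Nat.shiftRight_eq_div_pow]
  exact ⟨Nat.sub_le_iff_le_add.2 h2, h1⟩

/-- Either one point is within `2 ^ h` of all others, and there are few cells, or each occupied
cell of side `2 ^ h` has of the order of `2 ^ h` points in its neighborhood, while each point is
in at most `3 ^ d` such neighborhoods. -/
theorem card_image_gridCell_le {d w : ℕ} {S : Set (EuclideanSpace ℝ (Fin d))}
    (hS : IsPreconnected S) {P : Finset (GridPoint d w)} (hPS : ∀ q ∈ P, q.toEuclidean ∈ S)
    {R : ℝ} (hR : 0 ≤ R) (hcov : ∀ x ∈ S, ∃ q ∈ P, dist q.toEuclidean x ≤ R) (h : ℕ) :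
    ((P.image (gridCell h)).card : ℝ) ≤
      3 ^ d + (3 * R + 1) * (3 ^ d * P.card) * (1 / 2) ^ h := by
  by_cases hsmall : ∃ p ∈ P, ∀ q ∈ P, dist q.toEuclidean p.toEuclidean ≤ 2 ^ h
  · obtain ⟨p, _, hp⟩ := hsmall
    have hle : (P.image (gridCell h)).card ≤ 3 ^ d :=
      (Finset.card_le_card (Finset.image_subset_iff.2 fun q hq =>
        gridCell_mem_neighborCells (hp q hq))).trans (card_neighborCells_le _)
    have hle' : ((P.image (gridCell h)).card : ℝ) ≤ 3 ^ d := by exact_mod_cast hle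
    have : 0 ≤ (3 * R + 1) * (3 ^ d * P.card) * (1 / 2) ^ h := by positivity
    linarith
  push Not at hsmall
  have hK : 0 < 3 * R + 1 := by linarith
  have hdc := Finset.card_mul_le_card_mul (s := P.image (gridCell h)) (t := P)
    (fun c q => c ∈ neighborCells (gridCell h q)) (m := ⌈2 ^ h / (3 * R + 1)⌉₊) (n := 3 ^ d)
    (fun c hc => by
      obtain ⟨p, hp, rfl⟩ := Finset.mem_image.1 hc
      obtain ⟨r, hr, hpr⟩ := hsmall p hp
      have hcount := le_mul_card_of_isPreconnected hS hPS hR hcov hp hr (L := 2 ^ h)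
        (by positivity) (by rw [dist_comm]; exact hpr.le)
      rw [Nat.ceil_le, div_le_iff₀' hK]
      refine hcount.trans (mul_le_mul_of_nonneg_left ?_ hK.le)
      exact_mod_cast Finset.card_le_card
        (Finset.monotone_filter_right _ fun q _ hq => gridCell_mem_neighborCells hq))
    (fun q _ => (Finset.card_le_card fun c hc =>
      (Finset.mem_filter.1 hc).2).trans (card_neighborCells_le (gridCell h q)))
  have hdc' : ((P.image (gridCell h)).card : ℝ) * ⌈(2 : ℝ) ^ h / (3 * R + 1)⌉₊ ≤
      P.card * 3 ^ d := by exact_mod_cast hdc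
  have hceil := mul_le_mul_of_nonneg_left (Nat.le_ceil ((2 : ℝ) ^ h / (3 * R + 1)))
    (Nat.cast_nonneg (α := ℝ) (P.image (gridCell h)).card)
  have h1 := hceil.trans hdc'
  rw [mul_div_assoc', div_le_iff₀ hK, ← le_div_iff₀ (by positivity)] at h1
  have h2 : (P.card * 3 ^ d * (3 * R + 1) / 2 ^ h : ℝ) =
      (3 * R + 1) * (3 ^ d * P.card) * (1 / 2) ^ h := by
    rw [one_div, inv_pow]
    ring
  have : (0 : ℝ) < 3 ^ d := by positivity
  linarith

theorem sum_card_image_gridCell_le {d w : ℕ} {S : Set (EuclideanSpace ℝ (Fin d))}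
    (hS : IsPreconnected S) {P : Finset (GridPoint d w)} (hPS : ∀ q ∈ P, q.toEuclidean ∈ S)
    {R : ℝ} (hR : 0 ≤ R) (hcov : ∀ x ∈ S, ∃ q ∈ P, dist q.toEuclidean x ≤ R) :
    ((∑ h ∈ Finset.range w, (P.image (gridCell h)).card : ℕ) : ℝ) ≤
      3 ^ d * w + 2 * (3 * R + 1) * 3 ^ d * P.card := by
  rw [Nat.cast_sum]
  refine (Finset.sum_le_sum fun h _ => card_image_gridCell_le hS hPS hR hcov h).trans ?_
  rw [Finset.sum_add_distrib, ← Finset.mul_sum, Finset.sum_const, Finset.card_range, nsmul_eq_mul]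
  have hgeom := mul_le_mul_of_nonneg_left (sum_geometric_two_le w)
    (show 0 ≤ (3 * R + 1) * (3 ^ d * P.card) by positivity)
  linarith

theorem mainTheorem2 (d : ℕ) :
    (∀ w : ℕ, ∃ decode : List Bool → Finset (GridPoint d w),
      ∀ P : Finset (GridPoint d w), decode (xorCompress P) = P) ∧
    ∀ f₀ ε : ℝ, ∃ C : ℝ,
      ∀ (w : ℕ) (S : Set (EuclideanSpace ℝ (Fin d))) (f : EuclideanSpace ℝ (Fin d) → ℝ)
        (P : Finset (GridPoint d w)),
        IsCompact S → IsConnected S → (∀ x ∈ S, f x = f₀) →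
        IsEpsNet S f ε (GridPoint.toEuclidean '' (P : Set (GridPoint d w))) →
        ((xorCompress P).length : ℝ) ≤ C * ((w : ℝ) + (P.card : ℝ)) := by
  refine ⟨fun w => (xorCompress_injective d w).hasLeftInverse, fun f₀ ε => ?_⟩
  refine ⟨3 + d * (1 + 2 * (3 ^ d + 2 * (3 * |ε * f₀| + 1) * 3 ^ d)), ?_⟩
  intro w S f P _ hS hf hnet
  -- The absolute value makes the radius nonnegative whatever the signs of `ε` and `f₀`.
  have hcov : ∀ x ∈ S, ∃ q ∈ P, dist q.toEuclidean x ≤ |ε * f₀| := by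
    intro x hx
    obtain ⟨_, ⟨q, hq, rfl⟩, hqx⟩ := hnet.covering x hx
    rw [hf x hx] at hqx
    exact ⟨q, hq, hqx.trans (le_abs_self _)⟩
  have hPS : ∀ q ∈ P, q.toEuclidean ∈ S := fun q hq => hnet.subset ⟨q, hq, rfl⟩
  have hP : P.Nonempty := by
    obtain ⟨x, hx⟩ := hS.nonempty
    obtain ⟨q, hq, -⟩ := hcov x hx
    exact ⟨q, hq⟩
  have hlen : ((xorCompress P).length : ℝ) ≤ 3 * P.card + d * (w + P.card +
      2 * (∑ h ∈ Finset.range w, (P.image (gridCell h)).card : ℕ)) := by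
    exact_mod_cast length_xorCompress_le hP
  have hsum := sum_card_image_gridCell_le hS.isPreconnected hPS (abs_nonneg (ε * f₀)) hcov
  refine hlen.trans ?_
  have hbound : (w + P.card + 2 * (∑ h ∈ Finset.range w, (P.image (gridCell h)).card : ℕ) : ℝ) ≤
      (1 + 2 * (3 ^ d + 2 * (3 * |ε * f₀| + 1) * 3 ^ d)) * (w + P.card) := by
    have h1 : (0 : ℝ) ≤ 3 ^ d * P.card := by positivity
    have h2 : 0 ≤ 2 * (3 * |ε * f₀| + 1) * 3 ^ d * w := by positivity
    linarith
  have hmul := mul_le_mul_of_nonneg_left hbound (Nat.cast_nonneg (α := ℝ) d)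
  have hw : (0 : ℝ) ≤ w := Nat.cast_nonneg w
  linarith
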